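/- Let $A$ be a complex unital $*$-algebra with involution $a\mapsto a^+$. A $*$-representation $\pi$ of $A$ consists of a dense linear subspace $\mathcal D(\pi)$ of a Hilbert space $\mathcal H(\pi)$ and a unital algebra homomorphism $\pi$ of $A$ into the linear operators $\mathcal D(\pi)\to\mathcal D(\pi)$ such that $\langle\pi(a)\xi,\eta\rangle=\langle\xi,\pi(a^+)\eta\rangle$ for all $a\in A$ and $\xi,\eta\in\mathcal D(\pi)$. Put $$\mathcal D(\pi^*)=\bigcap_{a\in A}\mathcal D(\pi(a)^*),\quad \pi^*(a)=\pi(a^+)^*\lceil\mathcal D(\pi^*),\qquad \mathcal D(\pi^{**})=\bigcap_{a\in A}\mathcal D(\pi^*(a)^*),\quad \pi^{**}(a)=\pi^*(a^+)^*\lceil\mathcal D(\pi^{**}).$$ $\pi$ is called biclosed if $\pi=\pi^{**}$, and essentially self-adjoint if $\pi^{*}=\pi^{**}$. The symmetrized commutant is $$\pi(A)'_{ss}=\{T\in\mathbf B(\mathcal H(\pi)):\ T\,\overline{\pi(a)}\subseteq\overline{\pi(a)}\,T\ \text{ and }\ T^*\,\overline{\pi(a)}\subseteq\overline{\pi(a)}\,T^*\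 \text{ for all } a\in A\}.$$ For a positive linear functional $f$ on $A$ (that is, $f(a^+a)\ge 0$ for all $a\in A$) let $S(\pi,f)$ be the set of vectors $\varphi\in\mathcal D(\pi)$ with $f(a)=\langle\pi(a)\varphi,\varphi\rangle$ for all $a\in A$, and let $\pi_f$ be the GNS representation of $f$, which has domain $\pi_f(A)\varphi_f$ with $\varphi_f\in S(\pi_f,f)$. The transition probability of positive linear functionals $f,g$ on $A$ is $$P_A(f,g)=\sup_{\rho}\ \sup_{\varphi\in S(\rho,f),\,\psi\in S(\rho,g)}|\langle\varphi,\psi\rangle|^2,$$ where $\rho$ runs over all $*$-representations of $A$. **Theorem.** Let $f$ and $g$ be positive linear functionals on $A$ whose GNS representations $\pi_f$ and $\pi_g$ are essentially self-adjoint. Let $\pi$ be any biclosed $*$-representation of $A$ such that $S(\pi,f)$ and $S(\pi,g)$ are not empty, and let $\varphi\in S(\pi,f)$ and $\psi\in S(\pi,g)$ be arbitrary. Then $$P_A(f,g)=\sup_{T\in\pi(A)'_{ss},\ \|T\|\le 1}|\langle T\varphi,\psi\rangle|^2 .$$ -/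

import Mathlib

universe u w

open scoped InnerProductSpace

noncomputable section

/-- The operator family `a ↦ ρ(a)` of partially defined operators on `H`; a representation of `A`
on a domain in `H` is in particular such a family. -/
abbrev OpFamily (A : Type*) (H : Type*) [NormedAddCommGroup H] [InnerProductSpace ℂ H] :=
  A → H →ₗ.[ℂ] H

namespace OpFamily

variable {A : Type*} [Star A] {H : Type*} [NormedAddCommGroup H] [InnerProductSpace ℂ H]
  [CompleteSpace H]

/-- `D(ρ*) = ⋂ₐ D(ρ(a)*)`. -/
def adjointDomain (ρ : OpFamily A H) : Submodule ℂ H := ⨅ a : A, ((ρ a).adjoint).domain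

/-- The adjoint family `ρ*(a) = ρ(a⁺)* ↾ D(ρ*)`. -/
def adjoint (ρ : OpFamily A H) : OpFamily A H :=
  fun a => ((ρ (star a)).adjoint).domRestrict ρ.adjointDomain

end OpFamily

/-- A `*`-representation of the unital `*`-algebra `A` on a dense subspace `domain` of the Hilbert
space `H`. (The closability of each `π(a)` is automatic, see `StarRep.op_isClosable`.) -/
structure StarRep (A : Type*) [Ring A] [StarRing A] [Algebra ℂ A]
    (H : Type*) [NormedAddCommGroup H] [InnerProductSpace ℂ H] where
  domain : Submodule ℂ H
  dense_domain : Dense (domain : Set H)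
  toAlgHom : A →ₐ[ℂ] Module.End ℂ domain
  inner_map_left : ∀ (a : A) (x y : domain),
    ⟪((toAlgHom a x : domain) : H), (y : H)⟫_ℂ = ⟪(x : H), ((toAlgHom (star a) y : domain) : H)⟫_ℂ

/-- A positive linear functional on the `*`-algebra `A`: `f(a⁺a) ≥ 0` for all `a`. -/
structure PosFunctional (A : Type*) [Ring A] [StarRing A] [Algebra ℂ A] where
  toLinearMap : A →ₗ[ℂ] ℂ
  re_nonneg : ∀ a : A, 0 ≤ (toLinearMap (star a * a)).re
  im_eq_zero : ∀ a : A, (toLinearMap (star a * a)).im = 0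

instance {A : Type*} [Ring A] [StarRing A] [Algebra ℂ A] :
    CoeFun (PosFunctional A) (fun _ => A → ℂ) := ⟨fun f => f.toLinearMap⟩

namespace StarRep

variable {A : Type*} [Ring A] [StarRing A] [Algebra ℂ A]
  {H : Type*} [NormedAddCommGroup H] [InnerProductSpace ℂ H]

/-- `π(a)` as a partially defined operator on `H` with domain `D(π)`. -/
def op (π : StarRep A H) : OpFamily A H :=
  fun a => ⟨π.domain, π.domain.subtype ∘ₗ π.toAlgHom a⟩

/-- `S(π, f)`: the vectors `φ ∈ D(π)` with `f(a) = ⟨π(a)φ, φ⟩` for all `a` (Mathlib's inner product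
is linear in the second variable). -/
def repVectors (π : StarRep A H) (f : PosFunctional A) : Set H :=
  {φ | ∃ h : φ ∈ π.domain, ∀ a : A, f a = ⟪φ, ((π.toAlgHom a ⟨φ, h⟩ : π.domain) : H)⟫_ℂ}

theorem isFormalAdjoint_op (π : StarRep A H) (a : A) :
    (π.op a).IsFormalAdjoint (π.op (star a)) := by
  intro x y
  exact (π.inner_map_left a x y)

variable [CompleteSpace H]

/-- `π = π**`. -/
def IsBiclosed (π : StarRep A H) : Prop := π.op.adjoint.adjoint = π.op

/-- `π*` is self-adjoint, that is, `π** = π*`. -/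
def IsEssentiallySelfAdjoint (π : StarRep A H) : Prop := π.op.adjoint.adjoint = π.op.adjoint

/-- `T S ⊆ S T` for a bounded operator `T` and a partially defined operator `S`. -/
def _root_.ContinuousLinearMap.IntertwinesPMap (T : H →L[ℂ] H) (S : H →ₗ.[ℂ] H) : Prop :=
  ∀ x : S.domain, ∃ h : T x ∈ S.domain, S ⟨T x, h⟩ = T (S x)

/-- The symmetrized commutant `π(A)'_ss`. -/
def symmCommutant (π : StarRep A H) : Set (H →L[ℂ] H) :=
  {T | ∀ a : A, T.IntertwinesPMap (π.op a).closure ∧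
    (ContinuousLinearMap.adjoint T).IntertwinesPMap (π.op a).closure}

theorem op_isClosable (π : StarRep A H) (a : A) : (π.op a).IsClosable := by
  have h : (π.op a) ≤ ((π.op (star a)).adjoint) :=
    LinearPMap.IsFormalAdjoint.le_adjoint π.dense_domain (π.isFormalAdjoint_op a).symm
  exact (LinearPMap.adjoint_isClosed (T := π.op (star a)) π.dense_domain).isClosable.leIsClosable h

/-- `π ⊆ π*`. In particular every `π*(a)` is densely defined. -/
theorem op_le_adjoint (π : StarRep A H) (a : A) : π.op a ≤ π.op.adjoint a := by
  have h : ∀ b, (π.op b) ≤ ((π.op (star b)).adjoint) := fun b =>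
    LinearPMap.IsFormalAdjoint.le_adjoint π.dense_domain (π.isFormalAdjoint_op b).symm
  have hd : π.domain ≤ π.op.adjointDomain := by
    refine le_iInf fun b => ?_
    have := (h (star b)).1
    rwa [star_star] at this
  refine ⟨fun x hx => ⟨hd hx, (h a).1 hx⟩, fun x y hxy => ?_⟩
  exact ((h a).2 (x := x) (y := ⟨y, y.2.2⟩) hxy)

end StarRep

/-! ### The GNS representation -/

namespace PosFunctional

variable {A : Type u} [Ring A] [StarRing A] [Algebra ℂ A]

/-- A copy of `A` carrying the semi-inner product `(a, b) ↦ f(a⁺b)`. -/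
@[nolint unusedArguments]
def PreGNS (_f : PosFunctional A) : Type u := A

instance (f : PosFunctional A) : AddCommGroup f.PreGNS := inferInstanceAs (AddCommGroup A)
instance (f : PosFunctional A) : Module ℂ f.PreGNS := inferInstanceAs (Module ℂ A)

/-- The identity map `A → PreGNS f`. -/
def toPre (f : PosFunctional A) : A ≃ₗ[ℂ] f.PreGNS := LinearEquiv.refl ℂ A

variable [StarModule ℂ A]

theorem map_star_mul (f : PosFunctional A) (x y : A) :
    (starRingEnd ℂ) (f (star y * x)) = f (star x * y) := by
  have h1 := f.im_eq_zero (x + y)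
  have h2 := f.im_eq_zero (x + Complex.I • y)
  have hx := f.im_eq_zero x
  have hy := f.im_eq_zero y
  simp only [star_add, star_smul, add_mul, mul_add, map_add, smul_mul_assoc, mul_smul_comm,
    map_smul, smul_eq_mul, Complex.add_im, Complex.mul_im, Complex.mul_re, Complex.star_def,
    Complex.conj_I, Complex.neg_re, Complex.neg_im, Complex.I_re, Complex.I_im] at h1 h2
  apply Complex.ext
  · simp only [Complex.conj_re]; linarith
  · simp only [Complex.conj_im]; linarith

/-- The semi-inner product `(a, b) ↦ f(a⁺b)` (conjugate linear in `a`). -/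
abbrev preCore (f : PosFunctional A) : PreInnerProductSpace.Core ℂ f.PreGNS where
  inner a b := f (star (f.toPre.symm a) * f.toPre.symm b)
  conj_inner_symm x y := f.map_star_mul _ _
  re_inner_nonneg x := f.re_nonneg _
  add_left x y z := by rw [map_add, star_add, add_mul, map_add]
  smul_left x y r := by simp

instance (f : PosFunctional A) : SeminormedAddCommGroup f.PreGNS :=
  InnerProductSpace.Core.toSeminormedAddCommGroup (c := f.preCore)
instance (f : PosFunctional A) : InnerProductSpace ℂ f.PreGNS :=
  InnerProductSpace.ofCore f.preCore

/-- The GNS Hilbert space `H(π_f)`. -/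
abbrev GNSSpace (f : PosFunctional A) : Type u := UniformSpace.Completion f.PreGNS

/-- `a ↦ π_f(a)φ_f`, as a linear map of `A` into the GNS Hilbert space. -/
def gnsMap (f : PosFunctional A) : A →ₗ[ℂ] f.GNSSpace :=
  (UniformSpace.Completion.toComplₗᵢ (𝕜 := ℂ) (E := f.PreGNS)).toLinearMap ∘ₗ f.toPre.toLinearMap

theorem inner_gnsMap (f : PosFunctional A) (a b : A) :
    ⟪f.gnsMap a, f.gnsMap b⟫_ℂ = f (star a * b) :=
  UniformSpace.Completion.inner_coe (𝕜 := ℂ) (f.toPre a) (f.toPre b)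

theorem dense_range_gnsMap (f : PosFunctional A) :
    Dense ((LinearMap.range f.gnsMap : Submodule ℂ f.GNSSpace) : Set f.GNSSpace) := by
  have h : DenseRange ((↑) : f.PreGNS → f.GNSSpace) := UniformSpace.Completion.denseRange_coe
  refine h.mono ?_
  rintro _ ⟨x, rfl⟩
  exact ⟨f.toPre.symm x, rfl⟩

theorem gnsMap_mul_eq_zero (f : PosFunctional A) (a b : A) (hb : f.gnsMap b = 0) :
    f.gnsMap (a * b) = 0 := by
  have h : ⟪f.gnsMap (a * b), f.gnsMap (a * b)⟫_ℂ = 0 := by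
    rw [inner_gnsMap, star_mul, mul_assoc, ← inner_gnsMap, hb, inner_zero_left]
  exact inner_self_eq_zero.mp h

/-- Left multiplication by `a` on the range of `gnsMap`: it maps `π_f(b)φ_f` to `π_f(ab)φ_f`. -/
def gnsEnd (f : PosFunctional A) (a : A) : Module.End ℂ (LinearMap.range f.gnsMap) :=
  f.gnsMap.quotKerEquivRange.conj
    ((LinearMap.ker f.gnsMap).mapQ (LinearMap.ker f.gnsMap) (LinearMap.mulLeft ℂ a)
      (fun b hb => f.gnsMap_mul_eq_zero a b hb))

theorem gnsEnd_apply (f : PosFunctional A) (a b : A) :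
    f.gnsEnd a (f.gnsMap.rangeRestrict b) = f.gnsMap.rangeRestrict (a * b) := by
  have h : ∀ c, f.gnsMap.rangeRestrict c =
      f.gnsMap.quotKerEquivRange (Submodule.Quotient.mk c) := fun c => rfl
  rw [h, h, gnsEnd, LinearEquiv.conj_apply_apply, LinearEquiv.symm_apply_apply]
  rfl

theorem gnsEnd_ext (f : PosFunctional A) {S T : Module.End ℂ (LinearMap.range f.gnsMap)}
    (h : ∀ c, S (f.gnsMap.rangeRestrict c) = T (f.gnsMap.rangeRestrict c)) : S = T := by
  refine LinearMap.ext fun x => ?_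
  obtain ⟨c, rfl⟩ := f.gnsMap.surjective_rangeRestrict x
  exact h c

theorem gnsEnd_inner (f : PosFunctional A) (a : A) (x y : LinearMap.range f.gnsMap) :
    ⟪(f.gnsEnd a x : f.GNSSpace), (y : f.GNSSpace)⟫_ℂ =
      ⟪(x : f.GNSSpace), (f.gnsEnd (star a) y : f.GNSSpace)⟫_ℂ := by
  obtain ⟨b, rfl⟩ := f.gnsMap.surjective_rangeRestrict x
  obtain ⟨c, rfl⟩ := f.gnsMap.surjective_rangeRestrict y
  rw [gnsEnd_apply, gnsEnd_apply]
  have h : ∀ d, ((f.gnsMap.rangeRestrict d : LinearMap.range f.gnsMap) : f.GNSSpace) =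
    f.gnsMap d := fun d => rfl
  rw [h, h, h, h, inner_gnsMap, inner_gnsMap, star_mul, mul_assoc]

/-- `a ↦ gnsEnd a` as a linear map. -/
def gnsLin (f : PosFunctional A) : A →ₗ[ℂ] Module.End ℂ (LinearMap.range f.gnsMap) where
  toFun := f.gnsEnd
  map_add' a b := f.gnsEnd_ext fun c => by
    rw [LinearMap.add_apply, gnsEnd_apply, gnsEnd_apply, gnsEnd_apply, add_mul, map_add]
  map_smul' r a := f.gnsEnd_ext fun c => by
    rw [RingHom.id_apply, LinearMap.smul_apply, gnsEnd_apply, gnsEnd_apply, smul_mul_assoc,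
      map_smul]

theorem gnsLin_one (f : PosFunctional A) : f.gnsLin 1 = 1 :=
  f.gnsEnd_ext fun c => (f.gnsEnd_apply 1 c).trans (by rw [one_mul, Module.End.one_apply])

theorem gnsLin_mul (f : PosFunctional A) (a b : A) :
    f.gnsLin (a * b) = f.gnsLin a * f.gnsLin b :=
  f.gnsEnd_ext fun c => by
    have h : ∀ d, f.gnsLin d = f.gnsEnd d := fun d => rfl
    rw [Module.End.mul_apply, h, h, h, gnsEnd_apply, gnsEnd_apply, gnsEnd_apply, mul_assoc]

/-- The GNS representation `π_f`, with domain `D(π_f) = π_f(A)φ_f`. -/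
def gns (f : PosFunctional A) : StarRep A f.GNSSpace where
  domain := LinearMap.range f.gnsMap
  dense_domain := f.dense_range_gnsMap
  toAlgHom := AlgHom.ofLinearMap f.gnsLin f.gnsLin_one f.gnsLin_mul
  inner_map_left := f.gnsEnd_inner

/-- The cyclic vector `φ_f`, which represents `f` in `π_f`. -/
theorem gnsMap_one_mem_repVectors (f : PosFunctional A) : f.gnsMap 1 ∈ f.gns.repVectors f := by
  refine ⟨⟨1, rfl⟩, fun a => ?_⟩
  have h : f.gns.toAlgHom a ⟨f.gnsMap 1, ⟨1, rfl⟩⟩ = f.gnsMap.rangeRestrict (a * 1) :=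
    f.gnsEnd_apply a 1
  rw [h, mul_one]
  exact ((f.inner_gnsMap 1 a).trans (by rw [star_one, one_mul])).symm

end PosFunctional

/-! ### The transition probability -/

section

variable {A : Type u} [Ring A] [StarRing A] [Algebra ℂ A]

/-- The numbers `|⟨φ, ψ⟩|²`, where `φ ∈ S(ρ, f)`, `ψ ∈ S(ρ, g)` and `ρ` runs through all
`*`-representations of `A` on Hilbert spaces (in a universe at least as large as that of `A`). -/
def transitionValues (f g : PosFunctional A) : Set ℝ :=
  {r | ∃ (H : Type (max u w)) (_ : NormedAddCommGroup H) (_ : InnerProductSpace ℂ H)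
    (_ : CompleteSpace H) (ρ : StarRep A H),
    ∃ φ ∈ ρ.repVectors f, ∃ ψ ∈ ρ.repVectors g, r = ‖⟪ψ, φ⟫_ℂ‖ ^ 2}

theorem bddAbove_transitionValues (f g : PosFunctional A) :
    BddAbove (transitionValues.{u, w} f g) := by
  refine ⟨(f 1).re * (g 1).re, ?_⟩
  rintro r ⟨H, _, _, _, ρ, φ, ⟨hφ, hf⟩, ψ, ⟨hψ, hg⟩, rfl⟩
  have h1 : (f 1).re = ‖φ‖ ^ 2 := by
    rw [hf 1, map_one, Module.End.one_apply]
    exact inner_self_eq_norm_sq (𝕜 := ℂ) φ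
  have h2 : (g 1).re = ‖ψ‖ ^ 2 := by
    rw [hg 1, map_one, Module.End.one_apply]
    exact inner_self_eq_norm_sq (𝕜 := ℂ) ψ
  rw [h1, h2, mul_comm, ← mul_pow]
  exact pow_le_pow_left₀ (norm_nonneg _) (norm_inner_le_norm ψ φ) 2

/-- The transition probability `P_A(f, g)`. -/
def transitionProbability (f g : PosFunctional A) : ℝ := sSup (transitionValues.{u, w} f g)

end

end

/-!
The relation `S.Intertwines ρ σ`, for operator families `ρ`, `σ` and a bounded operator `S`, says
that `S` maps the graph of each `ρ(a)` into the graph of `σ(a)`. It is stable under composition,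
and passing to adjoints reverses it: `S* : σ* → ρ*` (`Intertwines.adjoint`). The theorem rests on
two constructions.

*Every transition value is attained by a contraction in the commutant.* Vectors `φ ∈ S(π, f)` and
`ξ ∈ S(ρ, f)` give contractive intertwiners from `π_f` to `π` and to `ρ`, sending the cyclic vector
to `φ` and to `ξ`; similarly for `g`, `ψ` and `η` (`exists_gns_intertwiner`). With `W` the maps into
`π` and `V` those into `ρ`, put `T = W_g V_g* V_f W_f*`, so that `⟨Tφ, ψ⟩ = ⟨ξ, η⟩`. Now
`W_f* : π ⊆ π* → π_f*`, and dualizing `V_f* V_g : π_g → π_f*` gives `V_g* V_f : π_f** → π_g*`, while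
dualizing `W_g : π_g → π` twice gives `W_g : π_g** → π** = π`. Essential self-adjointness,
`π_f* = π_f**` and `π_g* = π_g**`, is exactly what makes these maps composable, whence `T : π → π`.
The construction is symmetric in `f` and `g`, so `T*` intertwines as well (`exists_contraction`).

*Every contraction in the commutant gives a transition value.* The symmetrized commutant is a
norm-closed `*`-algebra, so it contains, with a contraction `T`, also `B = (1 - T*T)^{1/2}`. As `π`
is biclosed, `T` and `B` leave `D(π)` invariant, and `(Tφ, Bφ)` represents `f` in `π ⊕ π`, while
`(ψ, 0)` represents `g` (`norm_inner_sq_mem_transitionValues`).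
-/

noncomputable section

/-! ### Graphs of adjoints -/

section Graph

variable {H : Type*} [NormedAddCommGroup H] [InnerProductSpace ℂ H] [CompleteSpace H]

theorem LinearPMap.mk_mem_graph_adjoint_iff {R : H →ₗ.[ℂ] H} (hR : Dense (R.domain : Set H))
    {x y : H} :
    (x, y) ∈ R.adjoint.graph ↔ ∀ u v : H, (u, v) ∈ R.graph → ⟪v, x⟫_ℂ = ⟪u, y⟫_ℂ := by
  simp only [LinearPMap.adjoint_graph_eq_graph_adjoint hR, Submodule.mem_adjoint_iff, sub_eq_zero]

namespace OpFamily

variable {A : Type*}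

theorem mem_adjointDomain_iff {ρ : OpFamily A H} {x : H} :
    x ∈ ρ.adjointDomain ↔ ∀ c, ∃ z, (x, z) ∈ (ρ c).adjoint.graph := by
  simp only [adjointDomain, Submodule.mem_iInf, LinearPMap.mem_domain_iff]

theorem mk_mem_graph_adjoint_iff [Star A] {ρ : OpFamily A H} {a : A} {x y : H} :
    (x, y) ∈ (ρ.adjoint a).graph ↔
      x ∈ ρ.adjointDomain ∧ (x, y) ∈ (ρ (star a)).adjoint.graph := by
  constructor
  · intro h
    have hx : x ∈ (ρ.adjoint a).domain := LinearPMap.mem_domain_of_mem_graph h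
    exact ⟨hx.1, LinearPMap.le_graph_of_le LinearPMap.domRestrict_le h⟩
  · rintro ⟨hx, h⟩
    obtain ⟨z, rfl, rfl⟩ := (LinearPMap.mem_graph_iff _).1 h
    exact (LinearPMap.mem_graph_iff _).2 ⟨⟨z, hx, z.2⟩, rfl, LinearPMap.domRestrict_apply rfl⟩

end OpFamily

end Graph

/-! ### Intertwining operators -/

namespace ContinuousLinearMap

section

variable {A : Type*} {H₁ H₂ H₃ : Type*}
  [NormedAddCommGroup H₁] [InnerProductSpace ℂ H₁] [NormedAddCommGroup H₂]
  [InnerProductSpace ℂ H₂] [NormedAddCommGroup H₃] [InnerProductSpace ℂ H₃]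

/-- `S ρ(a) ⊆ σ(a) S` for all `a`, expressed through graphs: `(x, y) ∈ graph ρ(a)` implies
`(Sx, Sy) ∈ graph σ(a)`. -/
def Intertwines (S : H₁ →L[ℂ] H₂) (ρ : OpFamily A H₁) (σ : OpFamily A H₂) : Prop :=
  ∀ a x y, (x, y) ∈ (ρ a).graph → (S x, S y) ∈ (σ a).graph

theorem Intertwines.comp {S : H₁ →L[ℂ] H₂} {S' : H₂ →L[ℂ] H₃} {ρ : OpFamily A H₁}
    {σ : OpFamily A H₂} {τ : OpFamily A H₃} (h' : S'.Intertwines σ τ) (h : S.Intertwines ρ σ) :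
    (S' ∘L S).Intertwines ρ τ :=
  fun a x y hxy => h' a _ _ (h a x y hxy)

theorem Intertwines.mono_left {S : H₁ →L[ℂ] H₂} {ρ ρ' : OpFamily A H₁} {σ : OpFamily A H₂}
    (h : S.Intertwines ρ σ) (hρ : ∀ a, ρ' a ≤ ρ a) : S.Intertwines ρ' σ :=
  fun a x y hxy => h a x y (LinearPMap.le_graph_of_le (hρ a) hxy)

theorem Intertwines.mono_right {S : H₁ →L[ℂ] H₂} {ρ : OpFamily A H₁} {σ σ' : OpFamily A H₂}
    (h : S.Intertwines ρ σ) (hσ : ∀ a, σ a ≤ σ' a) : S.Intertwines ρ σ' :=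
  fun a x y hxy => LinearPMap.le_graph_of_le (hσ a) (h a x y hxy)

/-- If `S` intertwines `ρ` with `σ`, then `S*` intertwines `σ*` with `ρ*`. -/
theorem Intertwines.adjoint [CompleteSpace H₁] [CompleteSpace H₂] [Star A] {S : H₁ →L[ℂ] H₂}
    {ρ : OpFamily A H₁} {σ : OpFamily A H₂}
    (h : S.Intertwines ρ σ) (hρ : ∀ a, Dense ((ρ a).domain : Set H₁))
    (hσ : ∀ a, Dense ((σ a).domain : Set H₂)) :
    (ContinuousLinearMap.adjoint S).Intertwines σ.adjoint ρ.adjoint := by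
  have key : ∀ c x z, (x, z) ∈ (σ c).adjoint.graph →
      (ContinuousLinearMap.adjoint S x, ContinuousLinearMap.adjoint S z) ∈
        (ρ c).adjoint.graph := by
    intro c x z hxz
    rw [LinearPMap.mk_mem_graph_adjoint_iff (hσ c)] at hxz
    rw [LinearPMap.mk_mem_graph_adjoint_iff (hρ c)]
    intro u v huv
    rw [ContinuousLinearMap.adjoint_inner_right, ContinuousLinearMap.adjoint_inner_right]
    exact hxz _ _ (h c u v huv)
  intro a x y hxy
  rw [OpFamily.mk_mem_graph_adjoint_iff] at hxy ⊢
  refine ⟨OpFamily.mem_adjointDomain_iff.2 fun c => ?_, key _ _ _ hxy.2⟩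
  obtain ⟨z, hz⟩ := OpFamily.mem_adjointDomain_iff.1 hxy.1 c
  exact ⟨_, key c x z hz⟩

theorem norm_comp_le_one {S : H₂ →L[ℂ] H₃} {R : H₁ →L[ℂ] H₂} (hS : ‖S‖ ≤ 1) (hR : ‖R‖ ≤ 1) :
    ‖S ∘L R‖ ≤ 1 :=
  (S.opNorm_comp_le R).trans (mul_le_one₀ hS (norm_nonneg _) hR)

end

section

variable {H : Type*} [NormedAddCommGroup H] [InnerProductSpace ℂ H]

theorem intertwinesPMap_iff {T : H →L[ℂ] H} {R : H →ₗ.[ℂ] H} :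
    T.IntertwinesPMap R ↔ ∀ x y, (x, y) ∈ R.graph → (T x, T y) ∈ R.graph := by
  constructor
  · intro h x y hxy
    obtain ⟨z, rfl, rfl⟩ := (LinearPMap.mem_graph_iff _).1 hxy
    obtain ⟨h1, h2⟩ := h z
    exact (LinearPMap.mem_graph_iff _).2 ⟨⟨_, h1⟩, rfl, h2⟩
  · intro h x
    obtain ⟨z, hz, hz'⟩ := (LinearPMap.mem_graph_iff _).1 (h _ _ (R.mem_graph x))
    change (z : H) = T x at hz
    change R z = T (R x) at hz'
    have hx : T x ∈ R.domain := by
      rw [← hz]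
      exact z.2
    exact ⟨hx, (congrArg R (Subtype.ext hz.symm)).trans hz'⟩

/-- An operator commuting with a closable `R` commutes with its closure. -/
theorem intertwinesPMap_closure {T : H →L[ℂ] H} {R : H →ₗ.[ℂ] H} (hR : R.IsClosable)
    (h : ∀ x y, (x, y) ∈ R.graph → (T x, T y) ∈ R.graph) : T.IntertwinesPMap R.closure := by
  rw [intertwinesPMap_iff, ← hR.graph_closure_eq_closure_graph]
  intro x y hxy
  exact map_mem_closure (f := fun p : H × H => (T p.1, T p.2)) (by fun_prop) hxy
    fun p hp => h p.1 p.2 hp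

end

end ContinuousLinearMap

/-! ### Representations and the symmetrized commutant -/

namespace StarRep

variable {A : Type*} [Ring A] [StarRing A] [Algebra ℂ A]
  {H : Type*} [NormedAddCommGroup H] [InnerProductSpace ℂ H]

theorem mk_mem_graph_op_iff {π : StarRep A H} {a : A} {x y : H} :
    (x, y) ∈ (π.op a).graph ↔ ∃ h : x ∈ π.domain, (π.toAlgHom a ⟨x, h⟩ : H) = y := by
  rw [LinearPMap.mem_graph_iff]
  constructor
  · rintro ⟨z, rfl, rfl⟩
    exact ⟨z.2, rfl⟩
  · rintro ⟨h, rfl⟩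
    exact ⟨⟨x, h⟩, rfl, rfl⟩

variable [CompleteSpace H]

theorem dense_domain_adjoint (π : StarRep A H) (a : A) :
    Dense ((π.op.adjoint a).domain : Set H) :=
  π.dense_domain.mono (π.op_le_adjoint a).1

/-- The closure of `π(c)` is contained in `π*(c⁺)*`. -/
theorem closure_op_le (π : StarRep A H) (c : A) :
    (π.op c).closure.graph ≤ (π.op.adjoint (star c)).adjoint.graph := by
  rw [← (π.op_isClosable c).graph_closure_eq_closure_graph]
  refine Submodule.topologicalClosure_minimal _ ?_
    (LinearPMap.adjoint_isClosed (π.dense_domain_adjoint (star c)))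
  rintro ⟨x, y⟩ hxy
  rw [LinearPMap.mk_mem_graph_adjoint_iff (π.dense_domain_adjoint (star c))]
  intro u v huv
  rw [OpFamily.mk_mem_graph_adjoint_iff, star_star,
    LinearPMap.mk_mem_graph_adjoint_iff (R := π.op c) π.dense_domain] at huv
  have := huv.2 x y hxy
  rw [← inner_conj_symm, ← this, inner_conj_symm]

/-- For a biclosed `π`, elements of the symmetrized commutant leave `D(π)` invariant and commute
with `π` there, because `D(π)` is the intersection of the domains of the closures of the `π(a)`. -/
theorem intertwines_of_mem_symmCommutant {π : StarRep A H} (hπ : π.IsBiclosed) {T : H →L[ℂ] H}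
    (hT : T ∈ π.symmCommutant) : T.Intertwines π.op π.op := by
  have key : ∀ c x y, (x, y) ∈ (π.op c).graph →
      (T x, T y) ∈ (π.op.adjoint (star c)).adjoint.graph := fun c x y hxy =>
    π.closure_op_le c (ContinuousLinearMap.intertwinesPMap_iff.1 (hT c).1 x y
      (LinearPMap.le_graph_of_le (LinearPMap.le_closure _) hxy))
  intro a x y hxy
  rw [← show π.op.adjoint.adjoint = π.op from hπ, OpFamily.mk_mem_graph_adjoint_iff]
  refine ⟨OpFamily.mem_adjointDomain_iff.2 fun c => ?_, key a x y hxy⟩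
  obtain ⟨hx, -⟩ := mk_mem_graph_op_iff.1 hxy
  have := key (star c) x _ (mk_mem_graph_op_iff.2 ⟨hx, rfl⟩)
  rw [star_star] at this
  exact ⟨_, this⟩

/-- The symmetrized commutant as a `*`-subalgebra of the bounded operators. -/
def symmCommutantSubalgebra (π : StarRep A H) : StarSubalgebra ℂ (H →L[ℂ] H) where
  carrier := π.symmCommutant
  mul_mem' {S T} hS hT a := by
    simp only [symmCommutant, Set.mem_ofPred_eq, ContinuousLinearMap.intertwinesPMap_iff] at *
    refine ⟨fun x y h => (hS a).1 _ _ ((hT a).1 x y h), fun x y h => ?_⟩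
    rw [← ContinuousLinearMap.star_eq_adjoint, star_mul]
    exact (hT a).2 _ _ ((hS a).2 x y h)
  add_mem' {S T} hS hT a := by
    simp only [symmCommutant, Set.mem_ofPred_eq, ContinuousLinearMap.intertwinesPMap_iff] at *
    refine ⟨fun x y h => add_mem ((hS a).1 x y h) ((hT a).1 x y h), fun x y h => ?_⟩
    rw [map_add]
    exact add_mem ((hS a).2 x y h) ((hT a).2 x y h)
  algebraMap_mem' r a := by
    simp only [ContinuousLinearMap.intertwinesPMap_iff, ← ContinuousLinearMap.star_eq_adjoint,
      ← algebraMap_star_comm]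
    exact ⟨fun x y h => Submodule.smul_mem _ r h, fun x y h => Submodule.smul_mem _ (star r) h⟩
  star_mem' {T} hT a := by
    rw [ContinuousLinearMap.star_eq_adjoint, ContinuousLinearMap.adjoint_adjoint]
    exact ⟨(hT a).2, (hT a).1⟩

theorem isClosed_symmCommutantSubalgebra (π : StarRep A H) :
    IsClosed (π.symmCommutantSubalgebra : Set (H →L[ℂ] H)) := by
  have hc : ∀ a, IsClosed ((π.op a).closure.graph : Set (H × H)) := fun a =>
    (π.op_isClosable a).closure_isClosed
  have h : (π.symmCommutantSubalgebra : Set (H →L[ℂ] H)) =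
      ⋂ (a : A) (p : (π.op a).closure.graph),
        {T | (T p.1.1, T p.1.2) ∈ ((π.op a).closure.graph : Set (H × H))} ∩
        {T | (ContinuousLinearMap.adjoint T p.1.1, ContinuousLinearMap.adjoint T p.1.2) ∈
          ((π.op a).closure.graph : Set (H × H))} := by
    ext T
    change T ∈ π.symmCommutant ↔ _
    simp only [symmCommutant, Set.mem_ofPred_eq, ContinuousLinearMap.intertwinesPMap_iff,
      Set.mem_iInter, Set.mem_inter_iff, SetLike.mem_coe, Subtype.forall, Prod.forall]
    exact forall_congr' fun a => ⟨fun h x y hxy => ⟨h.1 x y hxy, h.2 x y hxy⟩,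
      fun h => ⟨fun x y hxy => (h x y hxy).1, fun x y hxy => (h x y hxy).2⟩⟩
  rw [h]
  refine isClosed_iInter fun a => isClosed_iInter fun p => IsClosed.inter ?_ ?_
  · exact (hc a).preimage (by fun_prop)
  · have hadj : Continuous fun T : H →L[ℂ] H => ContinuousLinearMap.adjoint T :=
      ContinuousLinearMap.adjoint.continuous
    exact (hc a).preimage
      ((hadj.clm_apply continuous_const).prodMk (hadj.clm_apply continuous_const))

/-- A contraction `T` in the symmetrized commutant has a defect operator `B = (1 - T*T)^{1/2}` in
it. -/
theorem exists_defect_mem_symmCommutant (π : StarRep A H) {T : H →L[ℂ] H}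
    (hT : T ∈ π.symmCommutant) (hT1 : ‖T‖ ≤ 1) :
    ∃ B ∈ π.symmCommutant, ∀ x y, ⟪T x, T y⟫_ℂ + ⟪B x, B y⟫_ℂ = ⟪x, y⟫_ℂ := by
  set D : H →L[ℂ] H := 1 - star T * T with hD
  have hDm : D ∈ π.symmCommutantSubalgebra :=
    sub_mem (one_mem _) (mul_mem (star_mem (s := π.symmCommutantSubalgebra) hT) hT)
  have hDpos : 0 ≤ D := by
    rw [hD, sub_nonneg, ← CStarAlgebra.norm_le_one_iff_of_nonneg _ (star_mul_self_nonneg T),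
      CStarRing.norm_star_mul_self]
    exact mul_le_one₀ hT1 (norm_nonneg _) hT1
  have := π.isClosed_symmCommutantSubalgebra
  refine ⟨cfc Real.sqrt D, cfc_mem (s := π.symmCommutantSubalgebra) Real.sqrt hDm, ?_⟩
  have hsa : star (cfc Real.sqrt D) = cfc Real.sqrt D := (cfc_predicate Real.sqrt D).star_eq
  have hsq : star (cfc Real.sqrt D) * cfc Real.sqrt D = D := by
    rw [hsa, ← cfc_mul Real.sqrt Real.sqrt D]
    conv_rhs => rw [← cfc_id ℝ D]
    exact cfc_congr fun t ht => Real.mul_self_sqrt (spectrum_nonneg_of_nonneg hDpos ht)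
  intro x y
  have h1 : ∀ S : H →L[ℂ] H, ⟪S x, S y⟫_ℂ = ⟪x, (star S * S) y⟫_ℂ := fun S => by
    rw [mul_apply_eq_comp, ContinuousLinearMap.star_eq_adjoint,
      ContinuousLinearMap.adjoint_inner_right]
  rw [h1, h1, hsq, ← inner_add_right, ← add_apply, hD,
    add_sub_cancel, one_apply_eq_self]

end StarRep

/-! ### Direct sums -/

namespace StarRep

variable {A : Type*} [Ring A] [StarRing A] [Algebra ℂ A]
  {H K : Type*} [NormedAddCommGroup H] [InnerProductSpace ℂ H]
  [NormedAddCommGroup K] [InnerProductSpace ℂ K]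

/-- The domain `D(π) ⊕ D(σ)` of the direct sum, inside the Hilbert space `H ⊕ K`. -/
def prodDomain (π : StarRep A H) (σ : StarRep A K) : Submodule ℂ (WithLp 2 (H × K)) :=
  (π.domain.prod σ.domain).comap (WithLp.linearEquiv 2 ℂ (H × K)).toLinearMap

/-- The elements of `prodDomain` are the pairs of elements of the two domains. -/
def prodDomainEquiv (π : StarRep A H) (σ : StarRep A K) :
    (π.domain × σ.domain) ≃ₗ[ℂ] π.prodDomain σ where
  toFun p := ⟨WithLp.toLp 2 ((p.1 : H), (p.2 : K)), p.1.2, p.2.2⟩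
  invFun x := (⟨x.1.fst, x.2.1⟩, ⟨x.1.snd, x.2.2⟩)
  map_add' _ _ := rfl
  map_smul' _ _ := rfl
  left_inv _ := rfl
  right_inv _ := rfl

/-- The direct sum `π ⊕ σ`. -/
def prod (π : StarRep A H) (σ : StarRep A K) : StarRep A (WithLp 2 (H × K)) where
  domain := π.prodDomain σ
  dense_domain := by
    have h := (π.dense_domain.prod σ.dense_domain).preimage
      (WithLp.homeomorphProd 2 H K).isOpenMap
    exact h
  toAlgHom := ((π.prodDomainEquiv σ).conjAlgEquiv ℂ).toAlgHom.comp
    ((LinearMap.prodMapAlgHom ℂ π.domain σ.domain).comp (π.toAlgHom.prod σ.toAlgHom))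
  inner_map_left a x y := by
    rw [WithLp.prod_inner_apply, WithLp.prod_inner_apply]
    exact congrArg₂ (· + ·) (π.inner_map_left a ⟨x.1.fst, x.2.1⟩ ⟨y.1.fst, y.2.1⟩)
      (σ.inner_map_left a ⟨x.1.snd, x.2.2⟩ ⟨y.1.snd, y.2.2⟩)

theorem mem_repVectors_prod {π : StarRep A H} {σ : StarRep A K} {f : PosFunctional A} {x : H}
    {y : K} (hx : x ∈ π.domain) (hy : y ∈ σ.domain)
    (h : ∀ a, f a = ⟪x, (π.toAlgHom a ⟨x, hx⟩ : H)⟫_ℂ + ⟪y, (σ.toAlgHom a ⟨y, hy⟩ : K)⟫_ℂ) :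
    WithLp.toLp 2 (x, y) ∈ (π.prod σ).repVectors f := by
  refine ⟨⟨hx, hy⟩, fun a => ?_⟩
  rw [h a, WithLp.prod_inner_apply]
  rfl

end StarRep

/-! ### Contractions in the commutant give transition values -/

/-- The witnessing representation is `π ⊕ π`, with the vectors `(Tφ, (1 - T*T)^{1/2} φ)` and
`(ψ, 0)`. -/
theorem norm_inner_sq_mem_transitionValues {A : Type u} [Ring A] [StarRing A] [Algebra ℂ A]
    {f g : PosFunctional A} {H : Type (max u w)} [NormedAddCommGroup H] [InnerProductSpace ℂ H]
    [CompleteSpace H] {π : StarRep A H} (hπ : π.IsBiclosed) {φ ψ : H} (hφ : φ ∈ π.repVectors f)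
    (hψ : ψ ∈ π.repVectors g) {T : H →L[ℂ] H} (hT : T ∈ π.symmCommutant) (hT1 : ‖T‖ ≤ 1) :
    ‖⟪ψ, T φ⟫_ℂ‖ ^ 2 ∈ transitionValues.{u, w} f g := by
  obtain ⟨B, hB, hTB⟩ := π.exists_defect_mem_symmCommutant hT hT1
  obtain ⟨hφD, hφ⟩ := hφ
  obtain ⟨hψD, hψ⟩ := hψ
  have hTi := fun a => StarRep.mk_mem_graph_op_iff.1
    (StarRep.intertwines_of_mem_symmCommutant hπ hT a φ _
      (StarRep.mk_mem_graph_op_iff.2 ⟨hφD, rfl⟩))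
  have hBi := fun a => StarRep.mk_mem_graph_op_iff.1
    (StarRep.intertwines_of_mem_symmCommutant hπ hB a φ _
      (StarRep.mk_mem_graph_op_iff.2 ⟨hφD, rfl⟩))
  refine ⟨WithLp 2 (H × H), inferInstance, inferInstance, inferInstance, π.prod π,
    WithLp.toLp 2 (T φ, B φ), StarRep.mem_repVectors_prod (hTi 1).1 (hBi 1).1 fun a => ?_,
    WithLp.toLp 2 (ψ, 0), StarRep.mem_repVectors_prod hψD (zero_mem _) fun a => ?_, ?_⟩
  · rw [(hTi a).2, (hBi a).2, hTB, hφ a]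
  · rw [inner_zero_left, add_zero, hψ a]
  · rw [WithLp.prod_inner_apply]
    simp

/-! ### Transition values come from contractions in the commutant -/

namespace ContinuousLinearMap

variable {E F H K : Type*} [NormedAddCommGroup E] [InnerProductSpace ℂ E] [CompleteSpace E]
  [NormedAddCommGroup F] [InnerProductSpace ℂ F] [CompleteSpace F]
  [NormedAddCommGroup H] [InnerProductSpace ℂ H] [CompleteSpace H]
  [NormedAddCommGroup K] [InnerProductSpace ℂ K] [CompleteSpace K]

/-- The operator `W_F V_F* V_E W_E*` on `H`, which carries the relative position of the images of
`E` and `F` in `K` over to `H`. -/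
def transfer (WE : E →L[ℂ] H) (WF : F →L[ℂ] H) (VE : E →L[ℂ] K) (VF : F →L[ℂ] K) : H →L[ℂ] H :=
  WF ∘L (ContinuousLinearMap.adjoint VF ∘L VE) ∘L ContinuousLinearMap.adjoint WE

variable {WE : E →L[ℂ] H} {WF : F →L[ℂ] H} {VE : E →L[ℂ] K} {VF : F →L[ℂ] K}

theorem adjoint_transfer :
    ContinuousLinearMap.adjoint (transfer WE WF VE VF) = transfer WF WE VF VE := by
  simp only [transfer, ContinuousLinearMap.adjoint_comp, ContinuousLinearMap.adjoint_adjoint,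
    ContinuousLinearMap.comp_assoc]

theorem norm_transfer_le_one (hWE : ‖WE‖ ≤ 1) (hWF : ‖WF‖ ≤ 1) (hVE : ‖VE‖ ≤ 1)
    (hVF : ‖VF‖ ≤ 1) : ‖transfer WE WF VE VF‖ ≤ 1 :=
  norm_comp_le_one hWF (norm_comp_le_one
    (norm_comp_le_one ((ContinuousLinearMap.adjoint.norm_map VF).trans_le hVF) hVE)
    ((ContinuousLinearMap.adjoint.norm_map WE).trans_le hWE))

theorem inner_transfer (x y : H) :
    ⟪y, transfer WE WF VE VF x⟫_ℂ =
      ⟪VF (ContinuousLinearMap.adjoint WF y), VE (ContinuousLinearMap.adjoint WE x)⟫_ℂ := by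
  rw [transfer, ContinuousLinearMap.comp_apply, ContinuousLinearMap.comp_apply,
    ContinuousLinearMap.comp_apply, ← ContinuousLinearMap.adjoint_inner_left,
    ContinuousLinearMap.adjoint_inner_right]

end ContinuousLinearMap

namespace PosFunctional

variable {A : Type u} [Ring A] [StarRing A] [Algebra ℂ A] [StarModule ℂ A]
  {H : Type*} [NormedAddCommGroup H] [InnerProductSpace ℂ H] [CompleteSpace H]

/-- A vector `φ ∈ S(π, f)` determines a contraction `π_f(a)φ_f ↦ π(a)φ` that intertwines `π_f`
with `π`. -/
theorem exists_gns_intertwiner {f : PosFunctional A} {π : StarRep A H} {φ : H}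
    (hφ : φ ∈ π.repVectors f) :
    ∃ V : f.GNSSpace →L[ℂ] H, ‖V‖ ≤ 1 ∧ V (f.gnsMap 1) = φ ∧ V.Intertwines f.gns.op π.op ∧
      ContinuousLinearMap.adjoint V φ = f.gnsMap 1 := by
  obtain ⟨hD, hφ⟩ := hφ
  let L : A →ₗ[ℂ] H := π.domain.subtype ∘ₗ LinearMap.applyₗ ⟨φ, hD⟩ ∘ₗ π.toAlgHom.toLinearMap
  have hL : ∀ a, L a = π.toAlgHom a ⟨φ, hD⟩ := fun a => rfl
  have hinner : ∀ a b, ⟪L a, L b⟫_ℂ = ⟪f.gnsMap a, f.gnsMap b⟫_ℂ := fun a b => by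
    rw [f.inner_gnsMap, hφ, map_mul, Module.End.mul_apply]
    exact π.inner_map_left a ⟨φ, hD⟩ (π.toAlgHom b ⟨φ, hD⟩)
  have hnorm : ∀ a, ‖L a‖ ≤ 1 * ‖f.gnsMap a‖ := fun a => by
    rw [one_mul, @norm_eq_sqrt_re_inner ℂ, @norm_eq_sqrt_re_inner ℂ _ _ _ _ (f.gnsMap a), hinner]
  have hdense : DenseRange f.gnsMap := f.dense_range_gnsMap
  have hV : ∀ a, L.extendOfNorm f.gnsMap (f.gnsMap a) = L a :=
    LinearMap.extendOfNorm_eq hdense ⟨1, hnorm⟩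
  have hV1 : L.extendOfNorm f.gnsMap (f.gnsMap 1) = φ := by
    rw [hV, hL, map_one, Module.End.one_apply]
  refine ⟨L.extendOfNorm f.gnsMap,
    LinearMap.opNorm_extendOfNorm_le hdense zero_le_one hnorm, hV1, ?_, ?_⟩
  · intro a x y hxy
    obtain ⟨⟨b, rfl⟩, rfl⟩ := StarRep.mk_mem_graph_op_iff.1 hxy
    have hab : (f.gns.toAlgHom a ⟨f.gnsMap b, b, rfl⟩ : f.GNSSpace) = f.gnsMap (a * b) :=
      congrArg Subtype.val (f.gnsEnd_apply a b)
    rw [hab, hV, hV, StarRep.mk_mem_graph_op_iff]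
    exact ⟨(π.toAlgHom b ⟨φ, hD⟩).2, by
      rw [hL (a * b), map_mul, Module.End.mul_apply]
      rfl⟩
  · refine Dense.eq_of_inner_right (𝕜 := ℂ) f.dense_range_gnsMap ?_
    rintro _ ⟨b, rfl⟩
    rw [ContinuousLinearMap.adjoint_inner_right, hV, ← hinner]
    congr 1
    rw [hL, map_one, Module.End.one_apply]

/-- If `V_f` and `V_g` intertwine the essentially self-adjoint GNS representations `π_f` and `π_g`
with `ρ`, and `W_f` and `W_g` intertwine them with the biclosed `π`, then `W_g V_g* V_f W_f*`
commutes with `π`. -/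
theorem intertwines_transfer {f g : PosFunctional A} (hf : f.gns.IsEssentiallySelfAdjoint)
    (hg : g.gns.IsEssentiallySelfAdjoint) {π : StarRep A H} (hπ : π.IsBiclosed)
    {K : Type*} [NormedAddCommGroup K] [InnerProductSpace ℂ K] [CompleteSpace K]
    {ρ : StarRep A K} {Wf : f.GNSSpace →L[ℂ] H} {Wg : g.GNSSpace →L[ℂ] H}
    {Vf : f.GNSSpace →L[ℂ] K} {Vg : g.GNSSpace →L[ℂ] K}
    (hWf : Wf.Intertwines f.gns.op π.op) (hWg : Wg.Intertwines g.gns.op π.op)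
    (hVf : Vf.Intertwines f.gns.op ρ.op) (hVg : Vg.Intertwines g.gns.op ρ.op) :
    (ContinuousLinearMap.transfer Wf Wg Vf Vg).Intertwines π.op π.op := by
  have h1 : (ContinuousLinearMap.adjoint Wf).Intertwines π.op f.gns.op.adjoint :=
    (hWf.adjoint (fun _ => f.gns.dense_domain) fun _ => π.dense_domain).mono_left π.op_le_adjoint
  -- Composing `V_f* : ρ* → π_f*` with `V_g` needs only `ρ ⊆ ρ*`, so `ρ` may be arbitrary.
  have h2 : (ContinuousLinearMap.adjoint Vg ∘L Vf).Intertwines f.gns.op.adjoint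
      g.gns.op.adjoint := by
    have h : (ContinuousLinearMap.adjoint Vf ∘L Vg).Intertwines g.gns.op f.gns.op.adjoint :=
      (hVf.adjoint (fun _ => f.gns.dense_domain) fun _ => ρ.dense_domain).comp
        (hVg.mono_right ρ.op_le_adjoint)
    have h' := h.adjoint (fun _ => g.gns.dense_domain) f.gns.dense_domain_adjoint
    rwa [show f.gns.op.adjoint.adjoint = f.gns.op.adjoint from hf,
      ContinuousLinearMap.adjoint_comp, ContinuousLinearMap.adjoint_adjoint] at h'
  have h3 : Wg.Intertwines g.gns.op.adjoint π.op := by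
    have h := (hWg.adjoint (fun _ => g.gns.dense_domain) fun _ => π.dense_domain).adjoint
      π.dense_domain_adjoint g.gns.dense_domain_adjoint
    rwa [show g.gns.op.adjoint.adjoint = g.gns.op.adjoint from hg,
      show π.op.adjoint.adjoint = π.op from hπ, ContinuousLinearMap.adjoint_adjoint] at h
  exact h3.comp (h2.comp h1)

/-- Every number `⟨ξ, η⟩` with `ξ ∈ S(ρ, f)` and `η ∈ S(ρ, g)`, in any representation `ρ`, equals
`⟨Tφ, ψ⟩` for a contraction `T` in the symmetrized commutant of the biclosed `π`. -/
theorem exists_contraction {f g : PosFunctional A} (hf : f.gns.IsEssentiallySelfAdjoint)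
    (hg : g.gns.IsEssentiallySelfAdjoint) {π : StarRep A H} (hπ : π.IsBiclosed) {φ ψ : H}
    (hφ : φ ∈ π.repVectors f) (hψ : ψ ∈ π.repVectors g)
    {K : Type*} [NormedAddCommGroup K] [InnerProductSpace ℂ K] [CompleteSpace K]
    {ρ : StarRep A K} {ξ η : K} (hξ : ξ ∈ ρ.repVectors f) (hη : η ∈ ρ.repVectors g) :
    ∃ T ∈ π.symmCommutant, ‖T‖ ≤ 1 ∧ ⟪ψ, T φ⟫_ℂ = ⟪η, ξ⟫_ℂ := by
  obtain ⟨Wf, nWf, -, hWf, eWf⟩ := exists_gns_intertwiner hφ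
  obtain ⟨Wg, nWg, -, hWg, eWg⟩ := exists_gns_intertwiner hψ
  obtain ⟨Vf, nVf, eVf, hVf, -⟩ := exists_gns_intertwiner hξ
  obtain ⟨Vg, nVg, eVg, hVg, -⟩ := exists_gns_intertwiner hη
  have comm : (ContinuousLinearMap.transfer Wf Wg Vf Vg).Intertwines π.op π.op :=
    intertwines_transfer hf hg hπ hWf hWg hVf hVg
  have comm' : (ContinuousLinearMap.transfer Wg Wf Vg Vf).Intertwines π.op π.op :=
    intertwines_transfer hg hf hπ hWg hWf hVg hVf
  refine ⟨ContinuousLinearMap.transfer Wf Wg Vf Vg, fun a => ⟨?_, ?_⟩,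
    ContinuousLinearMap.norm_transfer_le_one nWf nWg nVf nVg, ?_⟩
  · exact ContinuousLinearMap.intertwinesPMap_closure (π.op_isClosable a) (comm a)
  · rw [ContinuousLinearMap.adjoint_transfer]
    exact ContinuousLinearMap.intertwinesPMap_closure (π.op_isClosable a) (comm' a)
  · rw [ContinuousLinearMap.inner_transfer, eWf, eWg, eVf, eVg]

end PosFunctional

theorem mainTheorem2 {A : Type u} [Ring A] [StarRing A] [Algebra ℂ A] [StarModule ℂ A]
    (f g : PosFunctional A)
    (hf : f.gns.IsEssentiallySelfAdjoint) (hg : g.gns.IsEssentiallySelfAdjoint)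
    {H : Type (max u w)} [NormedAddCommGroup H] [InnerProductSpace ℂ H] [CompleteSpace H]
    (π : StarRep A H) (hπ : π.IsBiclosed)
    (φ ψ : H) (hφ : φ ∈ π.repVectors f) (hψ : ψ ∈ π.repVectors g) :
    IsLUB {r : ℝ | ∃ T ∈ π.symmCommutant, ‖T‖ ≤ 1 ∧ r = ‖⟪ψ, T φ⟫_ℂ‖ ^ 2}
      (transitionProbability.{u, w} f g) := by
  constructor
  · rintro r ⟨T, hT, hT1, rfl⟩
    exact le_csSup (bddAbove_transitionValues f g)
      (norm_inner_sq_mem_transitionValues hπ hφ hψ hT hT1)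
  · intro b hb
    refine csSup_le ⟨_, H, inferInstance, inferInstance, inferInstance, π, φ, hφ, ψ, hψ, rfl⟩ ?_
    rintro r ⟨K, _, _, _, ρ, ξ, hξ, η, hη, rfl⟩
    obtain ⟨T, hT, hT1, h⟩ := PosFunctional.exists_contraction hf hg hπ hφ hψ hξ hη
    exact hb ⟨T, hT, hT1, by rw [h]⟩

end
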